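/- Let $\mathbb F_q$ be a finite field with $q$ elements, $\ell$ a prime, and $\theta\colon\mathbb F_q\to\overline{\mathbb Q}_\ell^{\times}$ a non-trivial additive character. Let $\widehat{\mathbb F_q^\times}$ be the group of characters $\chi\colon\mathbb F_q^\times\to\overline{\mathbb Q}_\ell^\times$, each extended to $\mathbb F_q$ by $\chi(0)=0$, and write $\overline\chi=\chi^{-1}$ and $G(\chi)=\sum_{y\in\mathbb F_q^\times}\theta(y)\chi(y)$. Fix a generator $\rho$ of $\widehat{\mathbb F_q^\times}$. For $\beta\mid q-1$ put $\varphi_\beta=\rho^{(q-1)/\beta}$, and let $\psi[\varphi_\beta]$ denote the sequence $\psi,\psi\varphi_\beta,\dots,\psi\varphi_\beta^{\beta-1}$. For characters $C_1,\dots,C_m,D_1,\dots,D_m$ and $x\in\mathbb F_q$ put $${}_m\widetilde F_m\left(\begin{matrix}C_1,\dots,C_m\\ D_1,\dots,D_m\end{matrix};x\right)=\frac1{q-1}\sum_{\chi\in\widehat{\mathbb F_q^\times}}\prod_{i=1}^m\frac{G(C_i\chi)}{G(C_i)}\prod_{i=1}^m\frac{G(\overline{D_i\chi})}{G(\overline{D_i})}\,\chi(-1)^m\chi(x).$$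 Let $n\ge 0$, let $\alpha_1,\dots,\alpha_{n+1}$ be positive integers, put $\alpha=\alpha_1+\dots+\alpha_{n+1}$, and assume that $q\equiv 1$ modulo every $\alpha_i$ and modulo $\alpha$. Let $A_1,\dots,A_{n+1},B\in\widehat{\mathbb F_q^\times}$ and $x\in\mathbb F_q$. Then $$\begin{aligned}&\sum_{\chi\in\widehat{\mathbb F_q^\times}}\ \prod_{i=1}^{n+1}G\big((\overline{A_i\chi})^{\alpha_i}\big)\cdot G\big((B\chi)^{\alpha}\big)\,\chi\big((-1)^\alpha x\big)\\ &=(q-1)\prod_{i=1}^{n+1}A_i\big(\alpha_i^{-\alpha_i}\big)\cdot B\big(\alpha^\alpha\big)\prod_{i=1}^{n+1}\left\{G(\overline{A_i})\prod_{b=1}^{\alpha_i-1}\frac{G(\overline{A_i}\varphi_{\alpha_i}^{b})}{G(\varphi_{\alpha_i}^{b})}\right\}\cdot G(B)\prod_{b=1}^{\alpha-1}\frac{G(B\varphi_\alpha^{b})}{G(\varphi_\alpha^{b})}\\ &\qquad\times{}_\alpha\widetilde F_\alpha\left(\begin{matrix}B[\varphi_\alpha]\\ A_1[\varphi_{\alpha_1}],\dots,A_{n+1}[\varphi_{\alpha_{n+1}}]\end{matrix};\frac{\alpha^\alpha}{\alpha_1^{\alpha_1}\cdots\alpha_{n+1}^{\alpha_{n+1}}}\,x\right).\end{aligned}$$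 -/

import Mathlib

open scoped BigOperators

namespace FiniteHGF

noncomputable section

/-- The multiplicative characters of a finite field with values in a field are finite in number. -/
instance instFintypeMulChar {F K : Type*} [Field F] [Finite F] [Field K] :
    Fintype (MulChar F K) := Fintype.ofFinite _

/-- The hypergeometric function over the finite field `F` with upper parameters `A₁, …, A_m` and
lower parameters `B₁, …, B_m` (characters of `Fˣ`, extended by `0` to `F`), with respect to the
additive character `θ`:
`1/(q-1) * ∑_χ ∏ᵢ G(Aᵢχ)/G(Aᵢ) * ∏ᵢ G((Bᵢχ)⁻¹)/G(Bᵢ⁻¹) * χ(-1)^m * χ(x)`. -/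
def tildeF {F K : Type*} [Field F] [Fintype F] [Field K] (θ : AddChar F K) {m : ℕ}
    (A B : Fin m → MulChar F K) (x : F) : K :=
  1 / ((Fintype.card F : K) - 1) *
    ∑ χ : MulChar F K,
      (∏ i, gaussSum (A i * χ) θ / gaussSum (A i) θ) *
      (∏ i, gaussSum (B i * χ)⁻¹ θ / gaussSum (B i)⁻¹ θ) *
      χ (-1) ^ m * χ x

/-- For a generator `ρ` of the character group and `β ∣ q - 1`, the character
`φ_β = ρ ^ ((q - 1) / β)` of order `β`. -/
def phi {F K : Type*} [Field F] [Fintype F] [Field K] (ρ : MulChar F K) (β : ℕ) : MulChar F K :=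
  ρ ^ ((Fintype.card F - 1) / β)

/-- The sequence `ψ[φ_β] = ψ, ψ φ_β, …, ψ φ_β ^ (β - 1)`. -/
def paramSeq {F K : Type*} [Field F] [Fintype F] [Field K] (ρ ψ : MulChar F K) (β : ℕ) :
    Fin β → MulChar F K :=
  fun b => ψ * phi ρ β ^ (b : ℕ)

/-- The concatenation of finitely many finite sequences, in order. -/
def concatSeq {X : Type*} {k : ℕ} {len : Fin k → ℕ} (s : (i : Fin k) → Fin (len i) → X) :
    Fin (∑ i, len i) → X :=
  fun j => s (finSigmaFinEquiv.symm j).1 (finSigmaFinEquiv.symm j).2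

end

end FiniteHGF

namespace FiniteHGF

open Polynomial

/-! ### Euler products over monic polynomials -/

section EulerProduct

variable {F : Type*} [Field F] [Fintype F] {K : Type*} [Field K]

/-! The identity holds term by term in `χ`. The Hasse–Davenport product formula
(`prod_gaussSum_mul_pow`, solved for `G(ψ^m)` in `gaussSum_pow_eq`) turns each Gauss sum of a power
into a product over a coset of the powers of `φ_m`, and these products are those in `tildeF`.

Hasse–Davenport is proved with L-series over `F[X]`. The weight `χ(∏ roots) θ(∑ roots^m)` is
completely multiplicative, so the logarithmic derivative of its generating series is governed by
sums over prime powers (`natCast_mul_monicSum`). In degree `k` these are sums of `χ(N x) θ(Tr x^m)`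
over the extension of degree `k` (`primePowerSum_rootWeight`). Substituting `y = x^m` and counting
`m`-th roots with characters shows that the series for `(χ^m, m)` is the product of the series for
`(χ φ^b, 1)`, each of which is the polynomial `1 + G(χ φ^b) X` (`monicSeries_rootWeight`).

In the coefficient of `X^m`, one side is `∏ G(χ φ^b)`. On the other, Newton's identity isolates the
constant term of the polynomial and gives `χ(m^(-m)) G(χ^m)` times a sum not involving `χ`; the case
`χ = 1` evaluates that sum. -/

lemma finite_setOf_monic_natDegree_eq (F : Type*) [Field F] [Fintype F] (n : ℕ) :
    {f : F[X] | f.Monic ∧ f.natDegree = n}.Finite := by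
  refine Set.Finite.of_injOn (f := fun f (i : Fin n) => f.coeff i) (t := Set.univ)
    (fun _ _ => Set.mem_univ _) ?_ Set.finite_univ
  rintro f ⟨hf, hfn⟩ g ⟨hg, hgn⟩ h
  ext i
  rcases lt_trichotomy i n with hi | hi | hi
  · exact congrFun h ⟨i, hi⟩
  · have h1 : f.coeff i = 1 := by rw [hi, ← hfn]; exact hf
    have h2 : g.coeff i = 1 := by rw [hi, ← hgn]; exact hg
    rw [h1, h2]
  · rw [coeff_eq_zero_of_natDegree_lt (by omega), coeff_eq_zero_of_natDegree_lt (by omega)]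

/-- The monic polynomials of degree `n` over a finite field. -/
noncomputable def monicPolys (F : Type*) [Field F] [Fintype F] (n : ℕ) : Finset F[X] :=
  (finite_setOf_monic_natDegree_eq F n).toFinset

@[simp]
lemma mem_monicPolys {n : ℕ} {f : F[X]} : f ∈ monicPolys F n ↔ f.Monic ∧ f.natDegree = n := by
  simp [monicPolys]

lemma monicPolys_zero (F : Type*) [Field F] [Fintype F] : monicPolys F 0 = {1} := by
  ext f
  simp only [mem_monicPolys, Finset.mem_singleton]
  constructor
  · rintro ⟨h, h'⟩
    exact h.natDegree_eq_zero.mp h'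
  · rintro rfl
    exact ⟨monic_one, natDegree_one⟩

/-- The sum of a weight over the monic polynomials of degree `n`. -/
noncomputable def monicSum (c : F[X] →* K) (n : ℕ) : K := ∑ f ∈ monicPolys F n, c f

open Classical in
/-- The monic irreducible polynomials of degree at most `n`. -/
noncomputable def irredPolys (F : Type*) [Field F] [Fintype F] (n : ℕ) : Finset F[X] :=
  ((Finset.range (n + 1)).biUnion (monicPolys F)).filter Irreducible

lemma mem_irredPolys {n : ℕ} {f : F[X]} :
    f ∈ irredPolys F n ↔ f.Monic ∧ f.natDegree ≤ n ∧ Irreducible f := by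
  simp only [irredPolys, Finset.mem_filter, Finset.mem_biUnion, Finset.mem_range, mem_monicPolys]
  constructor
  · rintro ⟨⟨d, hd, hf, rfl⟩, hi⟩
    exact ⟨hf, by omega, hi⟩
  · rintro ⟨hf, hd, hi⟩
    exact ⟨⟨_, by omega, hf, rfl⟩, hi⟩

open Classical in
/-- The prime-power sum of a completely multiplicative weight in degree `k`. -/
noncomputable def primePowerSum (c : F[X] →* K) (k : ℕ) : K :=
  ∑ P ∈ (irredPolys F k).filter (fun P => P.natDegree ∣ k),
    (P.natDegree : K) * c P ^ (k / P.natDegree)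

lemma monicSum_zero (c : F[X] →* K) : monicSum c 0 = 1 := by
  rw [monicSum, monicPolys_zero, Finset.sum_singleton, map_one]

open Classical in
lemma sum_filter_dvd (c : F[X] →* K) {g : F[X]} (hg : g.Monic) (n : ℕ) :
    ∑ f ∈ (monicPolys F n).filter (g ∣ ·), c f =
      if g.natDegree ≤ n then c g * monicSum c (n - g.natDegree) else 0 := by
  split_ifs with h
  · rw [monicSum, Finset.mul_sum]
    symm
    refine Finset.sum_bij (fun f _ => g * f) ?_ ?_ ?_ ?_
    · intro f hf
      rw [mem_monicPolys] at hf
      rw [Finset.mem_filter, mem_monicPolys]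
      refine ⟨⟨hg.mul hf.1, ?_⟩, dvd_mul_right _ _⟩
      rw [hg.natDegree_mul hf.1, hf.2]
      omega
    · intro a _ b _ hab
      exact mul_left_cancel₀ hg.ne_zero hab
    · intro f hf
      rw [Finset.mem_filter, mem_monicPolys] at hf
      obtain ⟨⟨hf, hfn⟩, t, rfl⟩ := hf
      have ht : t.Monic := hg.of_mul_monic_left hf
      refine ⟨t, ?_, rfl⟩
      rw [hg.natDegree_mul ht] at hfn
      exact mem_monicPolys.mpr ⟨ht, by omega⟩
    · intro f _
      rw [map_mul]
  · refine Finset.sum_eq_zero fun f hf => ?_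
    rw [Finset.mem_filter, mem_monicPolys] at hf
    exact absurd (natDegree_le_of_dvd hf.2 hf.1.1.ne_zero) (by omega)

-- Unique factorization, with the multiplicity of `P` counted as the number of `j ≥ 1` with `P ^ j ∣
-- f`. In this form the sum over `f` can be exchanged with those over `P` and `j`.
open Classical in
lemma natDegree_eq_sum_irredPolys {f : F[X]} (hf : f.Monic) :
    f.natDegree = ∑ P ∈ irredPolys F f.natDegree, ∑ j ∈ Finset.Icc 1 f.natDegree,
      if P ^ j ∣ f then P.natDegree else 0 := by
  set s := UniqueFactorizationMonoid.normalizedFactors f with hs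
  have hprod : s.prod = f := by
    rw [hs, UniqueFactorizationMonoid.prod_normalizedFactors_eq hf.ne_zero, hf.normalize_eq_self]
  have hmem : ∀ P ∈ s, P.Monic ∧ Irreducible P ∧ P ∣ f := fun P hP => by
    have hi := UniqueFactorizationMonoid.irreducible_of_normalized_factor P hP
    refine ⟨?_, hi, UniqueFactorizationMonoid.dvd_of_mem_normalizedFactors hP⟩
    rw [← UniqueFactorizationMonoid.normalize_normalized_factor P hP]
    exact monic_normalize hi.ne_zero
  have hdeg : f.natDegree = (s.map natDegree).sum := by
    conv_lhs => rw [← hprod]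
    exact natDegree_multiset_prod_of_monic _ fun P hP => (hmem P hP).1
  have hcount : ∀ P ∈ irredPolys F f.natDegree,
      (∑ j ∈ Finset.Icc 1 f.natDegree, if P ^ j ∣ f then P.natDegree else 0) =
        s.count P * P.natDegree := by
    intro P hP
    rw [mem_irredPolys] at hP
    have hdvd : ∀ j, P ^ j ∣ f ↔ j ≤ s.count P := fun j => by
      rw [pow_dvd_iff_le_emultiplicity,
        UniqueFactorizationMonoid.emultiplicity_eq_count_normalizedFactors hP.2.2 hf.ne_zero,
        hP.1.normalize_eq_self, Nat.cast_le]
    have hle : s.count P ≤ f.natDegree := by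
      have h1 := natDegree_le_of_dvd ((hdvd _).mpr le_rfl) hf.ne_zero
      rw [hP.1.natDegree_pow] at h1
      exact (Nat.le_mul_of_pos_right _ hP.2.2.natDegree_pos).trans h1
    rw [← Finset.sum_filter, Finset.sum_const, smul_eq_mul]
    congr 1
    have : (Finset.Icc 1 f.natDegree).filter (fun j => P ^ j ∣ f) = Finset.Icc 1 (s.count P) := by
      ext j
      simp only [Finset.mem_filter, Finset.mem_Icc, hdvd]
      omega
    rw [this, Nat.card_Icc, Nat.add_sub_cancel]
  rw [Finset.sum_congr rfl hcount]
  conv_lhs => rw [hdeg, Finset.sum_multiset_map_count]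
  simp only [smul_eq_mul]
  refine Finset.sum_subset (fun P hP => ?_) fun P _ hP => ?_
  · obtain ⟨h1, h2, h3⟩ := hmem P (Multiset.mem_toFinset.mp hP)
    exact mem_irredPolys.mpr ⟨h1, natDegree_le_of_dvd h3 hf.ne_zero, h2⟩
  · rw [Multiset.mem_toFinset] at hP
    rw [Multiset.count_eq_zero_of_notMem hP, zero_mul]

lemma sum_mul_eq_sum_dvd {d n : ℕ} (hd : 0 < d) (g : ℕ → ℕ → K) :
    (∑ j ∈ Finset.Icc 1 n, if j * d ≤ n then g (j * d) j else 0) =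
      ∑ k ∈ Finset.Icc 1 n, if d ∣ k then g k (k / d) else 0 := by
  rw [← Finset.sum_filter, ← Finset.sum_filter]
  refine Finset.sum_nbij' (fun j => j * d) (fun k => k / d) ?_ ?_ ?_ ?_ ?_
  · intro j hj
    simp only [Finset.mem_filter, Finset.mem_Icc] at hj ⊢
    exact ⟨⟨Nat.mul_pos hj.1.1 hd, hj.2⟩, dvd_mul_left _ _⟩
  · intro k hk
    simp only [Finset.mem_filter, Finset.mem_Icc] at hk ⊢
    obtain ⟨⟨h1, h2⟩, t, rfl⟩ := hk
    rw [Nat.mul_div_cancel_left _ hd]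
    have : 0 < t := Nat.pos_of_mul_pos_left (by omega : 0 < d * t)
    exact ⟨⟨this, (Nat.le_mul_of_pos_left _ hd).trans h2⟩, by rwa [mul_comm]⟩
  · intro j _
    exact Nat.mul_div_cancel _ hd
  · intro k hk
    simp only [Finset.mem_filter] at hk
    exact Nat.div_mul_cancel hk.2
  · intro j _
    rw [Nat.mul_div_cancel _ hd]

/-- The logarithmic derivative of the Euler product of a completely multiplicative weight. -/
theorem natCast_mul_monicSum (c : F[X] →* K) (n : ℕ) :
    (n : K) * monicSum c n =
      ∑ k ∈ Finset.Icc 1 n, primePowerSum c k * monicSum c (n - k) := by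
  classical
  have h1 : (n : K) * monicSum c n = ∑ P ∈ irredPolys F n, ∑ j ∈ Finset.Icc 1 n,
      if j * P.natDegree ≤ n then
        (P.natDegree : K) * c P ^ j * monicSum c (n - j * P.natDegree) else 0 := by
    have : ∀ f ∈ monicPolys F n, (n : K) * c f = ∑ P ∈ irredPolys F n, ∑ j ∈ Finset.Icc 1 n,
        if P ^ j ∣ f then (P.natDegree : K) * c f else 0 := by
      intro f hf
      obtain ⟨hfm, rfl⟩ := mem_monicPolys.mp hf
      conv_lhs => rw [natDegree_eq_sum_irredPolys hfm]
      simp only [Nat.cast_sum, Finset.sum_mul, Nat.cast_ite, Nat.cast_zero, ite_mul, zero_mul]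
    -- For fixed `P` and `j`, the multiples `f = P ^ j * t` contribute `c P ^ j` times a lower
    -- `monicSum`.
    rw [monicSum, Finset.mul_sum, Finset.sum_congr rfl this, Finset.sum_comm]
    refine Finset.sum_congr rfl fun P hP => ?_
    rw [Finset.sum_comm]
    refine Finset.sum_congr rfl fun j _ => ?_
    rw [← Finset.sum_filter, ← Finset.mul_sum,
      sum_filter_dvd c ((mem_irredPolys.mp hP).1.pow j), (mem_irredPolys.mp hP).1.natDegree_pow,
      map_pow]
    split_ifs
    · ring
    · ring
  rw [h1]
  have h2 : ∀ k ∈ Finset.Icc 1 n, primePowerSum c k * monicSum c (n - k) =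
      ∑ P ∈ irredPolys F n, if P.natDegree ∣ k then
        (P.natDegree : K) * c P ^ (k / P.natDegree) * monicSum c (n - k) else 0 := by
    intro k hk
    rw [Finset.mem_Icc] at hk
    rw [primePowerSum, Finset.sum_mul, ← Finset.sum_filter]
    refine Finset.sum_congr ?_ fun _ _ => rfl
    ext P
    simp only [Finset.mem_filter, mem_irredPolys]
    constructor
    · rintro ⟨⟨h, h', h''⟩, hd⟩
      exact ⟨⟨h, h'.trans hk.2, h''⟩, hd⟩
    · rintro ⟨⟨h, h', h''⟩, hd⟩
      exact ⟨⟨h, Nat.le_of_dvd hk.1 hd, h''⟩, hd⟩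
  rw [Finset.sum_congr rfl h2, Finset.sum_comm (s := Finset.Icc 1 n)]
  refine Finset.sum_congr rfl fun P hP => ?_
  exact sum_mul_eq_sum_dvd (mem_irredPolys.mp hP).2.2.natDegree_pos
    (fun k j => (P.natDegree : K) * c P ^ j * monicSum c (n - k))

end EulerProduct

/-! ### Power sums of roots, read from the coefficients -/

section PowerSums

variable {F : Type*} [Field F]

open PowerSeries in
/-- Minus the logarithmic derivative of the reverse of a polynomial; its coefficients are the power
sums of the roots. -/
noncomputable def logSeries (f : F[X]) : PowerSeries F :=
  -(PowerSeries.X * d⁄dX F (f.reverse : PowerSeries F)) * (f.reverse : PowerSeries F)⁻¹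

/-- The sum of the `m`-th powers of the roots of `f`, for `0 < m`. -/
noncomputable def powerSum (m : ℕ) (f : F[X]) : F := PowerSeries.coeff m (logSeries f)

lemma constantCoeff_reverse_ne_zero {f : F[X]} (hf : f ≠ 0) :
    PowerSeries.constantCoeff (f.reverse : PowerSeries F) ≠ 0 := by
  rw [Polynomial.constantCoeff_coe, coeff_zero_reverse]
  exact leadingCoeff_ne_zero.mpr hf

open PowerSeries in
lemma logSeries_mul_reverse {f : F[X]} (hf : f ≠ 0) :
    logSeries f * (f.reverse : PowerSeries F) =
      -(PowerSeries.X * d⁄dX F (f.reverse : PowerSeries F)) := by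
  rw [logSeries, mul_assoc, PowerSeries.inv_mul_cancel _ (constantCoeff_reverse_ne_zero hf), mul_one]

lemma constantCoeff_logSeries (f : F[X]) : PowerSeries.constantCoeff (logSeries f) = 0 := by
  simp [logSeries]

lemma coe_reverse_ne_zero {f : F[X]} (hf : f ≠ 0) : (f.reverse : PowerSeries F) ≠ 0 := by
  intro h
  exact constantCoeff_reverse_ne_zero hf (by rw [h, map_zero])

lemma logSeries_mul {f g : F[X]} (hf : f ≠ 0) (hg : g ≠ 0) :
    logSeries (f * g) = logSeries f + logSeries g := by
  refine mul_right_cancel₀ (coe_reverse_ne_zero (mul_ne_zero hf hg)) ?_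
  rw [logSeries_mul_reverse (mul_ne_zero hf hg), reverse_mul_of_domain, Polynomial.coe_mul,
    Derivation.leibniz, smul_eq_mul, smul_eq_mul]
  linear_combination (-(g.reverse : PowerSeries F)) * logSeries_mul_reverse hf
    - (f.reverse : PowerSeries F) * logSeries_mul_reverse hg

lemma powerSum_mul (m : ℕ) {f g : F[X]} (hf : f ≠ 0) (hg : g ≠ 0) :
    powerSum m (f * g) = powerSum m f + powerSum m g := by
  rw [powerSum, logSeries_mul hf hg, map_add, powerSum, powerSum]

@[simp]
lemma powerSum_one (m : ℕ) : powerSum m (1 : F[X]) = 0 := by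
  have := powerSum_mul m (one_ne_zero : (1 : F[X]) ≠ 0) one_ne_zero
  rw [mul_one] at this
  simpa using this

lemma reverse_X_mul_add_C {g : F[X]} (hg : g.Monic) (a : F) :
    (X * g + C a).reverse = g.reverse + C a * X ^ (g.natDegree + 1) := by
  have hdeg : (X * g + C a).natDegree = g.natDegree + 1 := by
    rw [natDegree_add_C, natDegree_X_mul hg.ne_zero]
  ext i
  rw [coeff_reverse, coeff_add, coeff_add, coeff_reverse, hdeg, coeff_C_mul_X_pow, coeff_C]
  rcases lt_trichotomy i (g.natDegree + 1) with hi | hi | hi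
  · rw [revAt_le hi.le, revAt_le (by omega), if_neg (by omega), if_neg (by omega),
      Nat.sub_add_comm (by omega), coeff_X_mul]
  · rw [hi, revAt_le le_rfl, Nat.sub_self, coeff_X_mul_zero, revAt_eq_self_of_lt (by omega),
      coeff_eq_zero_of_natDegree_lt (by omega), if_pos rfl, if_pos rfl]
  · rw [revAt_eq_self_of_lt hi, revAt_eq_self_of_lt (by omega), if_neg (by omega),
      if_neg (by omega), coeff_eq_zero_of_natDegree_lt (p := g) (by omega),
      coeff_eq_zero_of_natDegree_lt (by rw [natDegree_X_mul hg.ne_zero]; exact hi)]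

lemma reverse_X_sub_C (a : F) : (X - C a : F[X]).reverse = 1 - C a * X := by
  have := reverse_X_mul_add_C (monic_one : (1 : F[X]).Monic) (-a)
  rw [mul_one, C_neg, ← sub_eq_add_neg, natDegree_one, zero_add, pow_one] at this
  rw [this, ← C_1, reverse_C]
  ring

lemma powerSum_X_sub_C {m : ℕ} (hm : 0 < m) (a : F) : powerSum m (X - C a) = a ^ m := by
  have h := logSeries_mul_reverse (X_sub_C_ne_zero a)
  have hR : ((X - C a : F[X]).reverse : PowerSeries F) =
      1 - PowerSeries.C a * PowerSeries.X := by
    rw [reverse_X_sub_C]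
    simp
  have hD : PowerSeries.derivative F (1 - PowerSeries.C a * PowerSeries.X) =
      -PowerSeries.C a := by
    simp [PowerSeries.derivative_C, PowerSeries.derivative_X]
  rw [hR, hD] at h
  -- Here `L * (1 - a X) = a X`, so the coefficients of `L` satisfy a geometric recursion.
  have hc : ∀ n, PowerSeries.coeff (n + 1) (logSeries (X - C a)) =
      a * PowerSeries.coeff n (logSeries (X - C a)) + if n = 0 then a else 0 := by
    intro n
    have h1 := congrArg (PowerSeries.coeff (n + 1)) h
    rw [mul_neg, neg_neg, mul_sub, mul_one, map_sub, mul_left_comm, ← mul_assoc,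
      PowerSeries.coeff_succ_mul_X, PowerSeries.coeff_C_mul, mul_comm PowerSeries.X,
      PowerSeries.coeff_succ_mul_X, PowerSeries.coeff_C] at h1
    rw [← h1]
    ring
  obtain ⟨n, rfl⟩ := Nat.exists_eq_succ_of_ne_zero hm.ne'
  induction n with
  | zero =>
    rw [powerSum, Nat.succ_eq_add_one, hc 0, PowerSeries.coeff_zero_eq_constantCoeff_apply,
      constantCoeff_logSeries]
    simp
  | succ n ih =>
    rw [powerSum, Nat.succ_eq_add_one, hc, if_neg (by omega), add_zero]
    rw [← powerSum, ih (by omega), ← pow_succ']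

lemma powerSum_prod_X_sub_C {ι : Type*} {m : ℕ} (hm : 0 < m) (s : Finset ι) (a : ι → F) :
    powerSum m (∏ i ∈ s, (X - C (a i))) = ∑ i ∈ s, a i ^ m := by
  classical
  induction s using Finset.induction_on with
  | empty => simp
  | insert i s hi ih =>
    rw [Finset.prod_insert hi, Finset.sum_insert hi, powerSum_mul m (X_sub_C_ne_zero _)
      (Finset.prod_ne_zero_iff.mpr fun j _ => X_sub_C_ne_zero _), ih, powerSum_X_sub_C hm]

lemma powerSum_map {E : Type*} [Field E] (φ : F →+* E) (m : ℕ) {f : F[X]} (hf : f ≠ 0) :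
    powerSum m (f.map φ) = φ (powerSum m f) := by
  have hr : (f.map φ).reverse = f.reverse.map φ := by
    ext i
    rw [coeff_map, coeff_reverse, coeff_reverse, coeff_map, natDegree_map]
  have hc : ((f.map φ).reverse : PowerSeries E) = PowerSeries.map φ (f.reverse : PowerSeries F) := by
    rw [hr]
    ext i
    simp
  have hf' : f.map φ ≠ 0 := (Polynomial.map_ne_zero_iff φ.injective).mpr hf
  have : logSeries (f.map φ) = PowerSeries.map φ (logSeries f) := by
    refine mul_right_cancel₀ (coe_reverse_ne_zero hf') ?_
    rw [logSeries_mul_reverse hf', hc, ← map_mul, logSeries_mul_reverse hf, map_neg, map_mul,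
      PowerSeries.map_X]
    congr 2
    ext i
    simp [PowerSeries.coeff_derivative]
  rw [powerSum, this, PowerSeries.coeff_map, powerSum]

/-- Newton's identity in top degree, valid in every characteristic: the constant term changes the
reverse only by `a X ^ m`, so the logarithmic series agree below degree `m` and the first difference
is `-m a`. -/
lemma powerSum_X_mul_add_C {g : F[X]} (hg : g.Monic) (a : F) :
    powerSum (g.natDegree + 1) (X * g + C a) =
      powerSum (g.natDegree + 1) (X * g) - ((g.natDegree + 1 : ℕ) : F) * a := by
  set m := g.natDegree + 1 with hm
  have hR (b : F) : ((X * g + C b).reverse : PowerSeries F) =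
      (g.reverse : PowerSeries F) + PowerSeries.C b * PowerSeries.X ^ m := by
    rw [reverse_X_mul_add_C hg b]
    simp [hm]
  have hne (b : F) : X * g + C b ≠ 0 := by
    intro h
    have := congrArg natDegree h
    rw [natDegree_add_C, natDegree_X_mul hg.ne_zero, natDegree_zero] at this
    omega
  have h1 := logSeries_mul_reverse (hne a)
  have h0 := logSeries_mul_reverse (hne 0)
  rw [hR] at h1 h0
  rw [C_0, add_zero, (PowerSeries.C (R := F)).map_zero, zero_mul, add_zero] at h0
  have hD : PowerSeries.derivative F (PowerSeries.C a * PowerSeries.X ^ m) =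
      PowerSeries.C a * ((m : PowerSeries F) * PowerSeries.X ^ (m - 1)) := by
    rw [Derivation.leibniz, PowerSeries.derivative_pow, PowerSeries.derivative_C,
      PowerSeries.derivative_X]
    simp
  rw [map_add, hD] at h1
  have hX : (PowerSeries.X : PowerSeries F) * PowerSeries.X ^ (m - 1) = PowerSeries.X ^ m := by
    rw [← pow_succ', hm, Nat.add_sub_cancel]
  have key : (logSeries (X * g + C a) - logSeries (X * g)) * (g.reverse : PowerSeries F) =
      PowerSeries.X ^ m * (-PowerSeries.C a * ((m : PowerSeries F) + logSeries (X * g + C a))) := by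
    linear_combination h1 - h0 - PowerSeries.C a * (m : PowerSeries F) * hX
  have hinv := PowerSeries.mul_inv_cancel _ (constantCoeff_reverse_ne_zero hg.ne_zero)
  have key2 : logSeries (X * g + C a) - logSeries (X * g) =
      PowerSeries.X ^ m * (-PowerSeries.C a * ((m : PowerSeries F) + logSeries (X * g + C a)) *
        (g.reverse : PowerSeries F)⁻¹) := by
    linear_combination (g.reverse : PowerSeries F)⁻¹ * key -
      (logSeries (X * g + C a) - logSeries (X * g)) * hinv
  have h3 := congrArg (PowerSeries.coeff m) key2
  rw [PowerSeries.coeff_X_pow_mul', if_pos le_rfl, Nat.sub_self,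
    PowerSeries.coeff_zero_eq_constantCoeff_apply, map_sub, map_mul, map_mul, map_neg, map_add,
    constantCoeff_logSeries, PowerSeries.constantCoeff_inv, Polynomial.constantCoeff_coe,
    coeff_zero_reverse, hg.leadingCoeff, map_natCast, PowerSeries.constantCoeff_C] at h3
  rw [powerSum, powerSum]
  linear_combination h3

end PowerSums

/-! ### The multiplicative weight -/

section Weight

variable {F : Type*} [Field F] {K : Type*} [Field K]

/-- The completely multiplicative weight `χ (∏ roots) θ (∑ roots ^ m)` on polynomials. -/
noncomputable def rootWeight (χ : MulChar F K) (θ : AddChar F K) (m : ℕ) : F[X] →* K where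
  toFun f := χ ((-1) ^ f.natDegree * f.coeff 0) * θ (powerSum m f)
  map_one' := by simp
  map_mul' f g := by
    -- `powerSum` is additive only on nonzero polynomials; at zero both sides vanish because `χ 0 =
    -- 0`.
    rcases eq_or_ne f 0 with rfl | hf
    · simp [MulChar.map_zero]
    rcases eq_or_ne g 0 with rfl | hg
    · simp [MulChar.map_zero]
    rw [natDegree_mul hf hg, mul_coeff_zero, powerSum_mul m hf hg, AddChar.map_add_eq_mul, pow_add,
      mul_mul_mul_comm, map_mul χ]
    ring

lemma rootWeight_apply (χ : MulChar F K) (θ : AddChar F K) (m : ℕ) (f : F[X]) :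
    rootWeight χ θ m f = χ ((-1) ^ f.natDegree * f.coeff 0) * θ (powerSum m f) := rfl

end Weight

/-! ### Prime-power sums as sums over extension fields -/

section Extension

variable {F : Type*} [Field F] [Fintype F] {K : Type*} [Field K]
  {E : Type*} [Field E] [Finite E] [Algebra F E]

-- Every monic irreducible factor of `h` has a root in `E`; that factor and `P` are both its minimal
-- polynomial.
omit [Fintype F] [Finite E] in
lemma eq_pow_of_forall_root {h P : F[X]} (hh : h.Monic) (hP : P.Monic) (hi : Irreducible P)
    (hs : (h.map (algebraMap F E)).Splits)
    (hr : ∀ y : E, aeval y h = 0 → aeval y P = 0) : ∃ r, h = P ^ r := by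
  classical
  refine ⟨Multiset.card (UniqueFactorizationMonoid.normalizedFactors h), ?_⟩
  have : ∀ Q ∈ UniqueFactorizationMonoid.normalizedFactors h, Q = P := by
    intro Q hQ
    have hQi := UniqueFactorizationMonoid.irreducible_of_normalized_factor Q hQ
    have hQh := UniqueFactorizationMonoid.dvd_of_mem_normalizedFactors hQ
    have hQm : Q.Monic := by
      rw [← UniqueFactorizationMonoid.normalize_normalized_factor Q hQ]
      exact monic_normalize hQi.ne_zero
    have hQs : (Q.map (algebraMap F E)).Splits :=
      hs.of_dvd ((Polynomial.map_ne_zero_iff (algebraMap F E).injective).mpr hh.ne_zero)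
        (Polynomial.map_dvd _ hQh)
    obtain ⟨y, hy⟩ := hQs.exists_eval_eq_zero (by
      rw [degree_map]; exact hQi.degree_pos.ne')
    rw [eval_map_algebraMap] at hy
    have hyP := hr y (by
      obtain ⟨t, rfl⟩ := hQh
      rw [map_mul, hy, zero_mul])
    rw [minpoly.eq_of_irreducible_of_monic hQi hy hQm,
      minpoly.eq_of_irreducible_of_monic hi hyP hP]
  rw [← Multiset.prod_replicate, ← Multiset.eq_replicate_card.mpr this,
    UniqueFactorizationMonoid.prod_normalizedFactors_eq hh.ne_zero, hh.normalize_eq_self]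

-- The product over the Galois group descends to `F`, and its roots are conjugates of `x`, so it is
-- a power of the minimal polynomial; comparing degrees gives the exponent.
omit [Fintype F] in
lemma map_minpoly_pow (x : E) :
    ((minpoly F x) ^ (Module.finrank F E / (minpoly F x).natDegree)).map (algebraMap F E) =
      ∏ σ : Gal(E/F), (X - C (σ x)) := by
  classical
  have hx : IsIntegral F x := IsIntegral.of_finite F x
  obtain ⟨h, hhmap, hhdeg, hhm⟩ : ∃ h : F[X], h.map (algebraMap F E) =
      ∏ σ : Gal(E/F), (X - C (σ x)) ∧ h.degree = (∏ σ : Gal(E/F), (X - C (σ x))).degree ∧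
        h.Monic := by
    have := Algebra.IsInvariant.charpoly_mem_lifts F E Gal(E/F) x
    exact Polynomial.lifts_and_degree_eq_and_monic this (MulSemiringAction.monic_charpoly _ _)
  have hs : (h.map (algebraMap F E)).Splits := by
    rw [hhmap]
    exact MulSemiringAction.splits_charpoly (G := Gal(E/F)) x
  obtain ⟨r, hr⟩ := eq_pow_of_forall_root hhm (minpoly.monic hx) (minpoly.irreducible hx) hs (by
    intro y hy
    rw [← eval_map_algebraMap, hhmap, eval_prod, Finset.prod_eq_zero_iff] at hy
    obtain ⟨σ, _, hσ⟩ := hy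
    rw [eval_sub, eval_X, eval_C, sub_eq_zero] at hσ
    rw [hσ, ← AlgEquiv.coe_toAlgHom σ, Polynomial.aeval_algHom_apply, minpoly.aeval, map_zero])
  have hd : h.natDegree = Module.finrank F E := by
    rw [← IsGalois.card_aut_eq_finrank, natDegree_eq_of_degree_eq hhdeg,
      natDegree_prod_of_monic _ _ fun _ _ => monic_X_sub_C _]
    simp [Nat.card_eq_fintype_card]
  rw [hr, (minpoly.monic hx).natDegree_pow] at hd
  rw [← hhmap, hr, ← hd, Nat.mul_div_cancel _ (minpoly.natDegree_pos hx)]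

omit [Fintype F] in
lemma rootWeight_minpoly_pow (χ : MulChar F K) (θ : AddChar F K) {m : ℕ} (hm : 0 < m) (x : E) :
    rootWeight χ θ m (minpoly F x) ^ (Module.finrank F E / (minpoly F x).natDegree) =
      χ (Algebra.norm F x) * θ (Algebra.trace F E (x ^ m)) := by
  have hx : IsIntegral F x := IsIntegral.of_finite F x
  have h := map_minpoly_pow (F := F) x
  set f := (minpoly F x) ^ (Module.finrank F E / (minpoly F x).natDegree) with hf
  have hfm : f.Monic := (minpoly.monic hx).pow _
  rw [← map_pow, ← hf, rootWeight_apply]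
  congr 2
  · apply (algebraMap F E).injective
    have hd : f.natDegree = Fintype.card Gal(E/F) := by
      rw [← natDegree_map (algebraMap F E), h, natDegree_prod_of_monic _ _ fun _ _ =>
        monic_X_sub_C _]
      simp
    rw [Algebra.norm_eq_prod_automorphisms, map_mul, ← coeff_map, h, coeff_zero_prod, map_pow,
      map_neg, map_one, hd]
    simp only [coeff_sub, coeff_X_zero, coeff_C_zero, zero_sub]
    rw [Finset.prod_neg, ← mul_assoc, Finset.card_univ, ← mul_pow]
    simp
  · apply (algebraMap F E).injective
    rw [← powerSum_map _ _ hfm.ne_zero, h, powerSum_prod_X_sub_C hm,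
      trace_eq_sum_automorphisms]
    simp only [map_pow]

-- Elements of `E` are grouped by minimal polynomial: an irreducible `P` of degree dividing `[E :
-- F]` splits in `E` with distinct roots, so its fibre has `P.natDegree` elements with equal
-- contributions.
open Classical in
theorem primePowerSum_rootWeight [Fintype E] (χ : MulChar F K) (θ : AddChar F K) {m : ℕ}
    (hm : 0 < m) :
    primePowerSum (rootWeight χ θ m) (Module.finrank F E) =
      ∑ x : E, χ (Algebra.norm F x) * θ (Algebra.trace F E (x ^ m)) := by
  have hmaps : ∀ x ∈ (Finset.univ : Finset E), minpoly F x ∈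
      (irredPolys F (Module.finrank F E)).filter (fun P => P.natDegree ∣ Module.finrank F E) := by
    intro x _
    have hx : IsIntegral F x := IsIntegral.of_finite F x
    rw [Finset.mem_filter, mem_irredPolys]
    exact ⟨⟨minpoly.monic hx, minpoly.natDegree_le x, minpoly.irreducible hx⟩,
      minpoly.degree_dvd hx⟩
  rw [← Finset.sum_fiberwise_of_maps_to hmaps, primePowerSum]
  refine Finset.sum_congr rfl fun P hP => ?_
  rw [Finset.mem_filter, mem_irredPolys] at hP
  obtain ⟨⟨hPm, -, hPi⟩, hPd⟩ := hP
  have hfib : (Finset.univ.filter fun x : E => minpoly F x = P) = (P.rootSet E).toFinset := by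
    ext x
    rw [Finset.mem_filter, Set.mem_toFinset, mem_rootSet]
    constructor
    · rintro ⟨-, rfl⟩
      exact ⟨hPi.ne_zero, minpoly.aeval _ _⟩
    · rintro ⟨-, h⟩
      exact ⟨Finset.mem_univ _, (minpoly.eq_of_irreducible_of_monic hPi h hPm).symm⟩
  have hsplit : (P.map (algebraMap F E)).Splits := by
    have h1 := hPi.natDegree_dvd_iff_dvd_X_pow_card_pow_sub_X.mp hPd
    have h2 : Nat.card F ^ Module.finrank F E = Nat.card E :=
      (Module.natCard_eq_pow_finrank (K := F) (V := E)).symm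
    rw [h2] at h1
    refine (Polynomial.splits_X_pow_nat_card_sub_X (K := E)).of_dvd
      (FiniteField.X_pow_card_sub_X_ne_zero E Finite.one_lt_card) ?_
    simpa using Polynomial.map_dvd (algebraMap F E) h1
  have hcard : (P.rootSet E).toFinset.card = P.natDegree := by
    rw [Set.toFinset_card]
    exact card_rootSet_eq_natDegree (PerfectField.separable_of_irreducible hPi) hsplit
  have hval : ∀ x ∈ (Finset.univ.filter fun x : E => minpoly F x = P),
      χ (Algebra.norm F x) * θ (Algebra.trace F E (x ^ m)) =
        rootWeight χ θ m P ^ (Module.finrank F E / P.natDegree) := by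
    intro x hx
    rw [Finset.mem_filter] at hx
    rw [← rootWeight_minpoly_pow χ θ hm, hx.2]
  rw [Finset.sum_congr rfl hval, Finset.sum_const, hfib, hcard, nsmul_eq_mul]

end Extension

/-! ### Roots of `x^m = y` in a finite field -/

section Roots

variable {E : Type*} [Field E] [Fintype E]

lemma exists_generator (E : Type*) [Field E] [Fintype E] :
    ∃ g : Eˣ, (∀ y : Eˣ, ∃ i : ℕ, g ^ i = y) ∧ orderOf g = Fintype.card E - 1 := by
  obtain ⟨g, hg⟩ := IsCyclic.exists_generator (α := Eˣ)
  refine ⟨g, fun y => ?_, ?_⟩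
  · obtain ⟨i, hi⟩ := mem_powers_iff_mem_zpowers.mpr (hg y)
    exact ⟨i, hi⟩
  · rw [orderOf_eq_card_of_forall_mem_zpowers hg, Nat.card_units, Nat.card_eq_fintype_card]

lemma exists_pow_eq_of_pow_eq_one {m : ℕ} (hm : m ∣ Fintype.card E - 1) {y : E} (hy : y ≠ 0)
    (h : y ^ ((Fintype.card E - 1) / m) = 1) : ∃ x, x ^ m = y := by
  obtain ⟨g, hg, hord⟩ := exists_generator E
  obtain ⟨i, hi⟩ := hg (Units.mk0 y hy)
  obtain ⟨t, ht⟩ := hm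
  have hpos : 0 < Fintype.card E - 1 := by have := Fintype.one_lt_card (α := E); omega
  have hm0 : 0 < m := Nat.pos_of_ne_zero fun h0 => by rw [h0, zero_mul] at ht; omega
  have ht0 : 0 < t := Nat.pos_of_ne_zero fun h0 => by rw [h0, mul_zero] at ht; omega
  have h1 : g ^ (i * t) = 1 := by
    rw [pow_mul, hi]
    ext
    rw [ht, Nat.mul_div_cancel_left _ hm0] at h
    simpa using h
  have h2 := orderOf_dvd_of_pow_eq_one h1
  rw [hord, ht] at h2
  obtain ⟨s, rfl⟩ := Nat.dvd_of_mul_dvd_mul_right ht0 h2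
  refine ⟨((g ^ s : Eˣ) : E), ?_⟩
  rw [← Units.val_pow_eq_pow_val, ← pow_mul, mul_comm, hi, Units.val_mk0]

open Classical in
lemma card_filter_pow_eq {m : ℕ} (hm : m ∣ Fintype.card E - 1) {x₀ : E} (hx₀ : x₀ ≠ 0) :
    (Finset.univ.filter fun x : E => x ^ m = x₀ ^ m).card = m := by
  obtain ⟨g, -, hord⟩ := exists_generator E
  have hpos : 0 < Fintype.card E - 1 := by have := Fintype.one_lt_card (α := E); omega
  have hm0 : 0 < m := Nat.pos_of_dvd_of_pos hm hpos
  obtain ⟨t, ht⟩ := hm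
  have hprim : IsPrimitiveRoot ((g : E) ^ t) m := by
    have : IsPrimitiveRoot (g : E) (Fintype.card E - 1) := by
      rw [← hord]
      exact IsPrimitiveRoot.coe_units_iff.mpr (IsPrimitiveRoot.orderOf g)
    exact this.pow hpos (by rw [ht, mul_comm])
  refine Eq.trans ?_ hprim.card_nthRootsFinset
  symm
  refine Finset.card_bij' (fun x _ => x₀ * x) (fun x _ => x / x₀) ?_ ?_ ?_ ?_
  · intro x hx
    rw [mem_nthRootsFinset hm0] at hx
    rw [Finset.mem_filter]
    exact ⟨Finset.mem_univ _, by rw [mul_pow, hx, mul_one]⟩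
  · intro x hx
    rw [Finset.mem_filter] at hx
    rw [mem_nthRootsFinset hm0, div_pow, hx.2, div_self (pow_ne_zero _ hx₀)]
  · intro x _
    exact mul_div_cancel_left₀ x hx₀
  · intro x _
    exact mul_div_cancel₀ x hx₀

end Roots

/-! ### Pulling back along the `m`-th power map -/

section PowerMap

variable {F : Type*} [Field F] [Fintype F] {K : Type*} [Field K]

-- Orthogonality: `φ ∘ N` detects `m`-th powers in `E`. If `φ (N y) = 1`, there are `m` roots and
-- every summand is `1`; otherwise there is no root and the geometric sum vanishes.
open Classical in
lemma card_filter_pow_eq_sum {E : Type*} [Field E] [Fintype E] [Algebra F E] {m : ℕ}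
    (hmq : m ∣ Fintype.card F - 1) {φ : MulChar F K} (hφ : φ ^ m = 1)
    (hker : ∀ u : F, u ≠ 0 → φ u = 1 → u ^ ((Fintype.card F - 1) / m) = 1)
    {y : E} (hy : y ≠ 0) :
    ((Finset.univ.filter fun x : E => x ^ m = y).card : K) =
      ∑ b ∈ Finset.range m, (φ ^ b) (Algebra.norm F y) := by
  have hdvd : Fintype.card F - 1 ∣ Fintype.card E - 1 := by
    rw [Module.card_eq_pow_finrank (K := F) (V := E)]
    exact Nat.sub_one_dvd_pow_sub_one _ _
  have hpos : 0 < Fintype.card F - 1 := by have := Fintype.one_lt_card (α := F); omega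
  have hm0 : 0 < m := Nat.pos_of_dvd_of_pos hmq hpos
  have hNy : Algebra.norm F y ≠ 0 := by rwa [Ne, Algebra.norm_eq_zero_iff]
  have hφb (b : ℕ) : (φ ^ b) (Algebra.norm F y) = φ (Algebra.norm F y) ^ b :=
    MulChar.pow_apply_coe φ b (Units.mk0 _ hNy)
  have hφm : φ (Algebra.norm F y) ^ m = 1 := by
    rw [← hφb, hφ, MulChar.one_apply hNy.isUnit]
  simp only [hφb]
  by_cases hw : φ (Algebra.norm F y) = 1
  · obtain ⟨x₀, rfl⟩ : ∃ x, x ^ m = y := by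
      refine exists_pow_eq_of_pow_eq_one (hmq.trans hdvd) hy ?_
      -- Since `N y = y ^ ((|E| - 1) / (|F| - 1))`, the relation from `hker` becomes `y ^ ((|E| - 1)
      -- / m) = 1`.
      have h1 := congrArg (algebraMap F E) (hker _ hNy hw)
      rw [map_pow, FiniteField.algebraMap_norm_eq_pow, map_one, ← pow_mul,
        Nat.card_eq_fintype_card, Nat.card_eq_fintype_card] at h1
      obtain ⟨s, hs⟩ := hdvd
      obtain ⟨t, ht⟩ := hmq
      rw [hs, Nat.mul_div_cancel_left _ hpos, ht, Nat.mul_div_cancel_left _ hm0] at h1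
      rw [hs, ht, mul_assoc, Nat.mul_div_cancel_left _ hm0, mul_comm]
      exact h1
    rw [card_filter_pow_eq (hmq.trans hdvd) (ne_zero_pow hm0.ne' hy), hw]
    simp
  · have h0 : (Finset.univ.filter fun x : E => x ^ m = y) = ∅ := by
      rw [Finset.filter_eq_empty_iff]
      rintro x - rfl
      apply hw
      have hx : Algebra.norm F x ≠ 0 := by
        rw [Ne, Algebra.norm_eq_zero_iff]
        exact ne_zero_pow hm0.ne' hy
      rw [map_pow, map_pow, ← MulChar.pow_apply' φ hm0.ne', hφ, MulChar.one_apply hx.isUnit]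
    rw [h0, Finset.card_empty, Nat.cast_zero]
    refine (mul_left_injective₀ (sub_ne_zero.mpr hw) ?_).symm
    simp only
    rw [geom_sum_mul, hφm, sub_self, zero_mul]

lemma sum_norm_trace_pow {E : Type*} [Field E] [Fintype E] [Algebra F E] {m : ℕ} (hm0 : 0 < m)
    (hmq : m ∣ Fintype.card F - 1) {φ : MulChar F K} (hφ : φ ^ m = 1)
    (hker : ∀ u : F, u ≠ 0 → φ u = 1 → u ^ ((Fintype.card F - 1) / m) = 1)
    (χ : MulChar F K) (θ : AddChar F K) :
    ∑ x : E, (χ ^ m) (Algebra.norm F x) * θ (Algebra.trace F E (x ^ m)) =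
      ∑ b ∈ Finset.range m, ∑ y : E,
        (χ * φ ^ b) (Algebra.norm F y) * θ (Algebra.trace F E (y ^ 1)) := by
  classical
  rw [Finset.sum_comm]
  have h1 : ∀ x : E, (χ ^ m) (Algebra.norm F x) * θ (Algebra.trace F E (x ^ m)) =
      χ (Algebra.norm F (x ^ m)) * θ (Algebra.trace F E (x ^ m)) := fun x => by
    rw [MulChar.pow_apply' χ hm0.ne', map_pow (Algebra.norm F), map_pow χ]
  simp only [h1]
  rw [← Finset.sum_fiberwise_of_maps_to (t := Finset.univ) (g := fun x : E => x ^ m)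
    fun x _ => Finset.mem_univ _]
  refine Finset.sum_congr rfl fun y _ => ?_
  have h2 : ∀ x ∈ Finset.univ.filter (fun x : E => x ^ m = y),
      χ (Algebra.norm F (x ^ m)) * θ (Algebra.trace F E (x ^ m)) =
        χ (Algebra.norm F y) * θ (Algebra.trace F E y) := fun x hx => by
    rw [(Finset.mem_filter.mp hx).2]
  rw [Finset.sum_congr rfl h2, Finset.sum_const, nsmul_eq_mul]
  rcases eq_or_ne y 0 with rfl | hy
  · simp [MulChar.map_zero]
  · rw [card_filter_pow_eq_sum hmq hφ hker hy, Finset.sum_mul]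
    refine Finset.sum_congr rfl fun b _ => ?_
    rw [MulChar.mul_apply, pow_one]
    ring

/-- The prime-power sums of the weight pulled back along the `m`-th power map. -/
lemma primePowerSum_pow {m : ℕ} (hm0 : 0 < m)
    (hmq : m ∣ Fintype.card F - 1) {φ : MulChar F K} (hφ : φ ^ m = 1)
    (hker : ∀ u : F, u ≠ 0 → φ u = 1 → u ^ ((Fintype.card F - 1) / m) = 1)
    (χ : MulChar F K) (θ : AddChar F K) {k : ℕ} (hk : 0 < k) :
    primePowerSum (rootWeight (χ ^ m) θ m) k =
      ∑ b ∈ Finset.range m, primePowerSum (rootWeight (χ * φ ^ b) θ 1) k := by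
  obtain ⟨p, hp⟩ := CharP.exists F
  have : Fact p.Prime := ⟨CharP.char_is_prime F p⟩
  have : NeZero k := ⟨hk.ne'⟩
  have hfin : Finite (FiniteField.Extension F p k) := Module.finite_of_finite F
  have := Fintype.ofFinite (FiniteField.Extension F p k)
  have hr := FiniteField.finrank_extension F p k
  have h (χ : MulChar F K) {m : ℕ} (hm : 0 < m) :=
    primePowerSum_rootWeight (E := FiniteField.Extension F p k) χ θ hm
  simp only [hr] at h
  rw [h _ hm0]
  simp only [h _ one_pos]
  exact sum_norm_trace_pow hm0 hmq hφ hker χ θ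

end PowerMap

/-! ### Generating series and logarithmic derivatives -/

section LogDerivative

variable {K : Type*} [Field K]

open PowerSeries in
lemma prod_logDeriv {ι : Type*} (s : Finset ι) (A P : ι → PowerSeries K)
    (h : ∀ i ∈ s, PowerSeries.X * d⁄dX K (A i) = A i * P i) :
    PowerSeries.X * d⁄dX K (∏ i ∈ s, A i) = (∏ i ∈ s, A i) * ∑ i ∈ s, P i := by
  classical
  induction s using Finset.induction_on with
  | empty => simp
  | insert i s hi ih =>
    rw [Finset.prod_insert hi, Finset.sum_insert hi, Derivation.leibniz, smul_eq_mul, smul_eq_mul]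
    linear_combination A i * ih (fun j hj => h j (Finset.mem_insert_of_mem hj)) +
      (∏ j ∈ s, A j) * h i (Finset.mem_insert_self i s)

-- The quotient `A / B` has zero derivative and constant term `1`; characteristic zero makes it
-- constant.
open PowerSeries in
lemma eq_of_logDeriv_eq [CharZero K] {A B P : PowerSeries K}
    (hA0 : PowerSeries.constantCoeff A = 1) (hB0 : PowerSeries.constantCoeff B = 1)
    (hA : PowerSeries.X * d⁄dX K A = A * P) (hB : PowerSeries.X * d⁄dX K B = B * P) : A = B := by
  have hinv : B * B⁻¹ = 1 := PowerSeries.mul_inv_cancel _ (by rw [hB0]; exact one_ne_zero)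
  have hD : PowerSeries.X * d⁄dX K (A * B⁻¹) = 0 := by
    rw [Derivation.leibniz, PowerSeries.derivative_inv', smul_eq_mul, smul_eq_mul]
    linear_combination B⁻¹ * hA - A * B⁻¹ ^ 2 * hB - A * P * B⁻¹ * hinv
  have h1 : A * B⁻¹ = 1 := by
    refine PowerSeries.derivative.ext ?_ ?_
    · rw [PowerSeries.derivative_one]
      exact (mul_eq_zero.mp hD).resolve_left PowerSeries.X_ne_zero
    · rw [map_mul, PowerSeries.constantCoeff_inv, hA0, hB0]
      simp
  linear_combination B * h1 - A * hinv

variable {F : Type*} [Field F] [Fintype F]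

/-- The generating series of the sums of a weight over monic polynomials. -/
noncomputable def monicSeries (c : F[X] →* K) : PowerSeries K := PowerSeries.mk (monicSum c)

lemma constantCoeff_monicSeries (c : F[X] →* K) :
    PowerSeries.constantCoeff (monicSeries c) = 1 := by
  rw [← PowerSeries.coeff_zero_eq_constantCoeff_apply, monicSeries, PowerSeries.coeff_mk,
    monicSum_zero]

open PowerSeries in
lemma X_mul_derivative_monicSeries (c : F[X] →* K) :
    PowerSeries.X * d⁄dX K (monicSeries c) =
      monicSeries c * PowerSeries.mk (fun k => if k = 0 then 0 else primePowerSum c k) := by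
  have hX : ∀ n, PowerSeries.coeff n (PowerSeries.X * d⁄dX K (monicSeries c)) =
      (n : K) * monicSum c n := by
    intro n
    cases n with
    | zero => simp
    | succ n =>
      rw [mul_comm PowerSeries.X, PowerSeries.coeff_succ_mul_X, PowerSeries.coeff_derivative,
        monicSeries, PowerSeries.coeff_mk]
      push_cast
      ring
  ext n
  rw [hX, natCast_mul_monicSum, mul_comm (monicSeries c), PowerSeries.coeff_mul,
    Finset.Nat.sum_antidiagonal_eq_sum_range_succ_mk]
  simp only [PowerSeries.coeff_mk, monicSeries]
  rw [Finset.sum_range_succ', if_pos rfl, zero_mul, add_zero, Finset.sum_bij']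
  case i => exact fun k _ => k - 1
  case j => exact fun k _ => k + 1
  all_goals simp only [Finset.mem_Icc, Finset.mem_range]
  · intro k hk; omega
  · intro k hk; omega
  · intro k hk; omega
  · intro k hk; omega
  · intro k hk
    rw [Nat.sub_add_cancel hk.1, if_neg (by omega)]

end LogDerivative

/-! ### Evaluating coefficients of the series -/

section Evaluation

variable {F : Type*} [Field F] [Fintype F] {K : Type*} [Field K]

lemma sum_monicPolys_succ (c : F[X] → K) (n : ℕ) :
    ∑ f ∈ monicPolys F (n + 1), c f = ∑ g ∈ monicPolys F n, ∑ a : F, c (X * g + C a) := by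
  rw [← Finset.sum_product']
  symm
  refine Finset.sum_bij' (fun p _ => X * p.1 + C p.2) (fun f _ => (f.divX, f.coeff 0)) ?_ ?_ ?_ ?_ ?_
  · rintro ⟨g, a⟩ hg
    simp only [Finset.mem_product, mem_monicPolys, Finset.mem_univ, and_true] at hg
    rw [mem_monicPolys, natDegree_add_C, natDegree_X_mul hg.1.ne_zero, hg.2]
    refine ⟨(monic_X.mul hg.1).add_of_left ?_, rfl⟩
    refine degree_C_le.trans_lt ?_
    rw [← natDegree_pos_iff_degree_pos, natDegree_X_mul hg.1.ne_zero]
    omega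
  · intro f hf
    rw [mem_monicPolys] at hf
    simp only [Finset.mem_product, mem_monicPolys, Finset.mem_univ, and_true]
    have hd : f.divX.natDegree = n := by rw [natDegree_divX_eq_natDegree_tsub_one, hf.2]; rfl
    refine ⟨?_, hd⟩
    rw [Monic, leadingCoeff, hd, coeff_divX, ← hf.2]
    exact hf.1
  · rintro ⟨g, a⟩ _
    refine Prod.ext ?_ ?_
    · ext i
      simp [coeff_divX]
    · simp
  · intro f _
    exact X_mul_divX_add f
  · intro p _
    rfl

omit [Fintype F] in
lemma powerSum_one_eq {f : F[X]} (hf : f.Monic) : powerSum 1 f = -f.nextCoeff := by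
  have h := congrArg (PowerSeries.coeff 1) (logSeries_mul_reverse hf.ne_zero)
  rw [PowerSeries.coeff_mul, Finset.Nat.sum_antidiagonal_eq_sum_range_succ_mk,
    Finset.sum_range_succ, Finset.sum_range_one, Nat.sub_zero, Nat.sub_self] at h
  rw [PowerSeries.coeff_zero_eq_constantCoeff_apply, constantCoeff_logSeries, zero_mul, zero_add,
    map_neg, mul_comm PowerSeries.X, ← zero_add 1, PowerSeries.coeff_succ_mul_X,
    PowerSeries.coeff_derivative, Polynomial.coeff_coe, Polynomial.coeff_coe, coeff_zero_reverse,
    hf.leadingCoeff] at h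
  simp only [zero_add, mul_one, coeff_one_reverse, Nat.cast_zero] at h
  exact h

lemma monicSum_rootWeight_one (χ : MulChar F K) (θ : AddChar F K) :
    monicSum (rootWeight χ θ 1) 1 = gaussSum χ θ := by
  rw [monicSum, sum_monicPolys_succ, monicPolys_zero, Finset.sum_singleton, gaussSum,
    ← Equiv.sum_comp (Equiv.neg F)]
  refine Finset.sum_congr rfl fun a _ => ?_
  rw [Equiv.neg_apply, mul_one, C_neg, ← sub_eq_add_neg, rootWeight_apply,
    powerSum_X_sub_C one_pos, natDegree_X_sub_C]
  simp

/-- For `n ≥ 2`, shifting the coefficient of `X ^ (n - 1)` leaves the constant term alone and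
changes the sum of the roots, so the sum is invariant under multiplication by some `θ b ≠ 1`. -/
lemma monicSum_rootWeight_eq_zero (χ : MulChar F K) {θ : AddChar F K} (hθ : θ ≠ 1) {n : ℕ}
    (hn : 2 ≤ n) : monicSum (rootWeight χ θ 1) n = 0 := by
  obtain ⟨b, hb⟩ := AddChar.ne_one_iff.mp hθ
  have hdeg : (C (-b) * X ^ (n - 1) : F[X]).natDegree < n := by
    have := natDegree_C_mul_X_pow_le (-b) (n - 1)
    omega
  have hdeg' : (C b * X ^ (n - 1) : F[X]).natDegree < n := by
    have := natDegree_C_mul_X_pow_le b (n - 1)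
    omega
  have hadd : ∀ h : F[X], h.natDegree < n → ∀ f ∈ monicPolys F n, f + h ∈ monicPolys F n := by
    intro h hh f hf
    rw [mem_monicPolys] at hf ⊢
    refine ⟨hf.1.add_of_left (degree_lt_degree (by omega)), ?_⟩
    rw [natDegree_add_eq_left_of_natDegree_lt (by omega), hf.2]
  have key : monicSum (rootWeight χ θ 1) n = θ b * monicSum (rootWeight χ θ 1) n := by
    rw [monicSum, Finset.mul_sum]
    refine Finset.sum_bij' (fun f _ => f + C b * X ^ (n - 1)) (fun f _ => f + C (-b) * X ^ (n - 1))
      (hadd _ hdeg') (hadd _ hdeg) ?_ ?_ ?_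
    · intro f _
      rw [C_neg]
      ring
    · intro f _
      rw [C_neg]
      ring
    · intro f hf
      have hf' := hadd _ hdeg' f hf
      rw [mem_monicPolys] at hf hf'
      rw [rootWeight_apply, rootWeight_apply, hf.2, hf'.2, powerSum_one_eq hf.1,
        powerSum_one_eq hf'.1, nextCoeff_of_natDegree_pos (by omega),
        nextCoeff_of_natDegree_pos (by omega), hf.2, hf'.2, coeff_add, coeff_add,
        coeff_C_mul_X_pow, coeff_C_mul_X_pow, if_neg (by omega), if_pos rfl, add_zero,
        mul_left_comm, ← AddChar.map_add_eq_mul]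
      congr 2
      ring
  have : (θ b - 1) * monicSum (rootWeight χ θ 1) n = 0 := by
    rw [sub_mul, one_mul, ← key, sub_self]
  exact (mul_eq_zero.mp this).resolve_left (sub_ne_zero.mpr hb)

lemma monicSeries_rootWeight (χ : MulChar F K) {θ : AddChar F K} (hθ : θ ≠ 1) :
    monicSeries (rootWeight χ θ 1) = ((1 + C (gaussSum χ θ) * X : K[X]) : PowerSeries K) := by
  ext n
  rw [monicSeries, PowerSeries.coeff_mk, Polynomial.coeff_coe, coeff_add, coeff_C_mul, coeff_X,
    coeff_one]
  rcases n with _ | _ | n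
  · rw [monicSum_zero]
    simp
  · rw [monicSum_rootWeight_one]
    simp
  · rw [monicSum_rootWeight_eq_zero χ hθ (by omega)]
    simp

/-- Writing `f = X g + a`, the constant term enters the power sum only as `-m a`. The substitution
`a ↦ -(m a)`, bijective as `m ≠ 0` in `F`, produces the Gauss sum, and what remains does not involve
`χ`. -/
lemma monicSum_rootWeight_pow (χ : MulChar F K) (θ : AddChar F K) {n : ℕ}
    (hn : ((n + 1 : ℕ) : F) ≠ 0) :
    monicSum (rootWeight (χ ^ (n + 1)) θ (n + 1)) (n + 1) =
      χ ((((n + 1 : ℕ) : F) ^ (n + 1))⁻¹) * gaussSum (χ ^ (n + 1)) θ *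
        ∑ g ∈ monicPolys F n, θ (powerSum (n + 1) (X * g)) := by
  rw [monicSum, sum_monicPolys_succ, Finset.mul_sum]
  refine Finset.sum_congr rfl fun g hg => ?_
  obtain ⟨hgm, rfl⟩ := mem_monicPolys.mp hg
  set m : ℕ := g.natDegree + 1 with hm
  have e : ∀ a : F, rootWeight (χ ^ m) θ m (X * g + C a) =
      (χ ^ m) ((-1) ^ m * a) * (θ (powerSum m (X * g)) * θ (-(m * a))) := by
    intro a
    rw [rootWeight_apply, powerSum_X_mul_add_C hgm, sub_eq_add_neg, AddChar.map_add_eq_mul,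
      natDegree_add_C, natDegree_X_mul hgm.ne_zero]
    simp [hm]
  simp only [e]
  have hG : gaussSum (χ ^ m) θ = ∑ a : F, (χ ^ m) (-(m * a)) * θ (-(m * a)) := by
    rw [gaussSum, ← Equiv.sum_comp (Equiv.mulLeft₀ (-(m : F)) (neg_ne_zero.mpr hn))]
    simp only [Equiv.mulLeft₀, Units.mulLeft_apply, Units.val_mk0, neg_mul]
  rw [hG, Finset.mul_sum, Finset.sum_mul]
  refine Finset.sum_congr rfl fun a _ => ?_
  have hsign : ((-1 : F) ^ m) ^ m = (-1) ^ m := by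
    rcases Nat.even_or_odd m with h | h
    · rw [h.neg_one_pow, one_pow]
    · rw [h.neg_one_pow, h.neg_one_pow]
  have : (χ ^ m) ((-1) ^ m * a) = χ (((m : F) ^ m)⁻¹) * (χ ^ m) (-(m * a)) := by
    rw [MulChar.pow_apply' χ (by omega), MulChar.pow_apply' χ (by omega), ← map_pow, ← map_pow,
      ← map_mul]
    congr 1
    rw [mul_pow, hsign, neg_pow ((m : F) * a), mul_pow]
    field_simp
  rw [this]
  ring

end Evaluation

/-! ### The Hasse–Davenport product formula -/

section HasseDavenport

variable {F : Type*} [Field F] [Fintype F] {K : Type*} [Field K] [CharZero K]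

lemma natCast_ne_zero_of_dvd_card_sub_one {m : ℕ} (hmq : m ∣ Fintype.card F - 1) :
    (m : F) ≠ 0 := by
  obtain ⟨t, ht⟩ := hmq
  have hpos := Fintype.one_lt_card (α := F)
  intro h
  have h1 : ((Fintype.card F - 1 : ℕ) : F) = 0 := by rw [ht, Nat.cast_mul, h, zero_mul]
  rw [Nat.cast_sub hpos.le, FiniteField.cast_card_eq_zero, Nat.cast_one, zero_sub] at h1
  exact one_ne_zero (neg_eq_zero.mp h1)

/-- The Hasse–Davenport product formula, with the product of the Gauss sums of powers of `φ`
replaced by an exponential sum independent of `χ`. -/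
lemma prod_gaussSum_eq_mul_sum {n : ℕ} (hmq : n + 1 ∣ Fintype.card F - 1)
    {φ : MulChar F K} (hφ : φ ^ (n + 1) = 1)
    (hker : ∀ u : F, u ≠ 0 → φ u = 1 → u ^ ((Fintype.card F - 1) / (n + 1)) = 1)
    (χ : MulChar F K) {θ : AddChar F K} (hθ : θ ≠ 1) :
    ∏ b ∈ Finset.range (n + 1), gaussSum (χ * φ ^ b) θ =
      χ ((((n + 1 : ℕ) : F) ^ (n + 1))⁻¹) * gaussSum (χ ^ (n + 1)) θ *
        ∑ g ∈ monicPolys F n, θ (powerSum (n + 1) (X * g)) := by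
  have hseries : monicSeries (rootWeight (χ ^ (n + 1)) θ (n + 1)) =
      ∏ b ∈ Finset.range (n + 1), monicSeries (rootWeight (χ * φ ^ b) θ 1) := by
    refine eq_of_logDeriv_eq (constantCoeff_monicSeries _) ?_ (X_mul_derivative_monicSeries _) ?_
    · rw [map_prod]
      exact Finset.prod_eq_one fun b _ => constantCoeff_monicSeries _
    · rw [prod_logDeriv _ _ _ fun b _ => X_mul_derivative_monicSeries _]
      congr 1
      ext k
      rw [map_sum]
      simp only [PowerSeries.coeff_mk]
      split_ifs with hk
      · simp
      · exact (primePowerSum_pow (Nat.succ_pos n) hmq hφ hker χ θ (Nat.pos_of_ne_zero hk)).symm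
  rw [← monicSum_rootWeight_pow χ θ (natCast_ne_zero_of_dvd_card_sub_one hmq)]
  have h := congrArg (PowerSeries.coeff (n + 1)) hseries
  simp only [monicSeries_rootWeight _ hθ] at h
  rw [monicSeries, PowerSeries.coeff_mk] at h
  rw [h]
  have hdeg : ∀ b ∈ Finset.range (n + 1),
      (1 + C (gaussSum (χ * φ ^ b) θ) * X : K[X]).natDegree ≤ 1 := fun b _ => by
    compute_degree
  have hcoe : (∏ b ∈ Finset.range (n + 1),
      ((1 + C (gaussSum (χ * φ ^ b) θ) * X : K[X]) : PowerSeries K)) =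
      ((∏ b ∈ Finset.range (n + 1), (1 + C (gaussSum (χ * φ ^ b) θ) * X) : K[X]) :
        PowerSeries K) := by
    simp only [← Polynomial.coeToPowerSeries.ringHom_apply]
    rw [map_prod]
  rw [hcoe, Polynomial.coeff_coe]
  -- The coefficient of `X ^ (n + 1)` in a product of `n + 1` linear factors is the product of their
  -- linear coefficients.
  have := coeff_prod_of_natDegree_le (s := Finset.range (n + 1))
    (fun b => (1 + C (gaussSum (χ * φ ^ b) θ) * X : K[X])) 1 hdeg
  rw [Finset.card_range, mul_one] at this
  rw [this]
  refine Finset.prod_congr rfl fun b _ => ?_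
  simp [coeff_one]

/-- The **Hasse–Davenport product formula** for Gauss sums. -/
theorem prod_gaussSum_mul_pow {m : ℕ} (hm : 0 < m) (hmq : m ∣ Fintype.card F - 1)
    {φ : MulChar F K} (hφ : φ ^ m = 1)
    (hker : ∀ u : F, u ≠ 0 → φ u = 1 → u ^ ((Fintype.card F - 1) / m) = 1)
    (χ : MulChar F K) {θ : AddChar F K} (hθ : θ ≠ 1) :
    ∏ b ∈ Finset.range m, gaussSum (χ * φ ^ b) θ =
      χ (((m : F) ^ m)⁻¹) * gaussSum (χ ^ m) θ *
        ∏ b ∈ Finset.Icc 1 (m - 1), gaussSum (φ ^ b) θ := by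
  obtain ⟨n, rfl⟩ := Nat.exists_eq_succ_of_ne_zero hm.ne'
  rw [Nat.succ_eq_add_one] at *
  rw [prod_gaussSum_eq_mul_sum hmq hφ hker χ hθ]
  congr 1
  -- At `χ = 1` the factor `G(1) = -1` occurs on both sides and cancels, leaving the value of the
  -- exponential sum.
  have h := prod_gaussSum_eq_mul_sum hmq hφ hker 1 hθ
  have hne := natCast_ne_zero_of_dvd_card_sub_one hmq
  rw [one_pow, gaussSum_one_left hθ, MulChar.one_apply (inv_ne_zero (pow_ne_zero _ hne)).isUnit,
    Finset.prod_range_succ', pow_zero, mul_one, gaussSum_one_left hθ] at h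
  have h2 : ∏ b ∈ Finset.Icc 1 (n + 1 - 1), gaussSum (φ ^ b) θ =
      ∏ b ∈ Finset.range n, gaussSum (1 * φ ^ (b + 1)) θ := by
    rw [Nat.add_sub_cancel, ← Finset.Ico_add_one_right_eq_Icc, Finset.prod_Ico_eq_prod_range]
    simp only [Nat.add_sub_cancel, one_mul, add_comm 1]
  rw [h2]
  linear_combination h

end HasseDavenport

/-! ### Coset products and the hypergeometric identity -/

section Parameters

variable {F : Type*} [Field F] [Fintype F] {K : Type*} [Field K]

lemma mulChar_pow_card_sub_one (χ : MulChar F K) : χ ^ (Fintype.card F - 1) = 1 := by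
  ext u
  rw [MulChar.pow_apply_coe, ← map_pow, FiniteField.pow_card_sub_one_eq_one _ u.ne_zero,
    MulChar.one_apply_coe, map_one]

lemma phi_pow {β : ℕ} (hβ : β ∣ Fintype.card F - 1) (ρ : MulChar F K) : phi ρ β ^ β = 1 := by
  rw [phi, ← pow_mul, Nat.div_mul_cancel hβ, mulChar_pow_card_sub_one]

/-- `phi ρ β u` is `ρ` evaluated at `u ^ ((q - 1) / β)`. An element killed by the generator `ρ` is
killed by all characters, and these separate points. -/
lemma pow_eq_one_of_phi_eq_one [HasEnoughRootsOfUnity K (Monoid.exponent Fˣ)]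
    {ρ : MulChar F K} (hρ : ∀ χ, χ ∈ Subgroup.zpowers ρ) (β : ℕ) {u : F} (hu : u ≠ 0)
    (h : phi ρ β u = 1) : u ^ ((Fintype.card F - 1) / β) = 1 := by
  by_contra hne
  obtain ⟨χ, hχ⟩ := MulChar.exists_apply_ne_one_of_hasEnoughRootsOfUnity F K hne
  obtain ⟨i, rfl⟩ := mem_powers_iff_mem_zpowers.mpr (hρ χ)
  apply hχ
  have h1 : ρ (u ^ ((Fintype.card F - 1) / β)) = 1 := by
    rw [map_pow, ← h]
    exact (MulChar.pow_apply_coe ρ _ (Units.mk0 u hu)).symm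
  have h2 := MulChar.pow_apply_coe ρ i (Units.mk0 _ (pow_ne_zero ((Fintype.card F - 1) / β) hu))
  rw [Units.val_mk0, h1, one_pow] at h2
  exact h2

lemma gaussSum_ne_zero [CharZero K] {θ : AddChar F K} (hθ : θ ≠ 1) (χ : MulChar F K) :
    gaussSum χ θ ≠ 0 := by
  rcases eq_or_ne χ 1 with rfl | hχ
  · rw [gaussSum_one_left hθ]
    exact neg_ne_zero.mpr one_ne_zero
  · exact gaussSum_ne_zero_of_nontrivial (Nat.cast_ne_zero.mpr Fintype.card_ne_zero) hχ
      (AddChar.IsPrimitive.of_ne_one hθ)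

/-- The product of the Gauss sums over a coset of the powers of `phi ρ m`. -/
noncomputable def cosetProd (ρ : MulChar F K) (θ : AddChar F K) (m : ℕ) (ψ : MulChar F K) : K :=
  ∏ b ∈ Finset.range m, gaussSum (ψ * phi ρ m ^ b) θ

lemma cosetProd_eq_mul {m : ℕ} (hm : 0 < m) (ρ : MulChar F K) (θ : AddChar F K)
    (ψ : MulChar F K) :
    cosetProd ρ θ m ψ =
      gaussSum ψ θ * ∏ b ∈ Finset.Icc 1 (m - 1), gaussSum (ψ * phi ρ m ^ b) θ := by
  obtain ⟨n, rfl⟩ := Nat.exists_eq_succ_of_ne_zero hm.ne'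
  rw [cosetProd, Nat.succ_eq_add_one, Finset.prod_range_succ', pow_zero, mul_one,
    Nat.add_sub_cancel, ← Finset.Ico_add_one_right_eq_Icc, Finset.prod_Ico_eq_prod_range, mul_comm]
  simp only [Nat.add_sub_cancel, add_comm 1]

lemma cosetProd_inv {m : ℕ} (hmq : m ∣ Fintype.card F - 1) (ρ : MulChar F K) (θ : AddChar F K)
    (ψ : MulChar F K) :
    ∏ b ∈ Finset.range m, gaussSum (ψ * phi ρ m ^ b)⁻¹ θ = cosetProd ρ θ m ψ⁻¹ := by
  rcases m with _ | n
  · simp [cosetProd]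
  rw [cosetProd, Finset.prod_range_succ', Finset.prod_range_succ']
  congr 1
  -- Inversion sends the exponent `b` to `m - b` modulo `m`: it fixes `b = 0` and reverses the
  -- others.
  · rw [← Finset.prod_range_reflect]
    refine Finset.prod_congr rfl fun b hb => ?_
    rw [Finset.mem_range] at hb
    congr 1
    rw [mul_inv]
    congr 1
    rw [inv_eq_iff_mul_eq_one, ← pow_add, ← phi_pow hmq ρ]
    congr 1
    omega
  · rw [pow_zero, mul_one, mul_one]

variable [CharZero K]

lemma cosetProd_ne_zero {θ : AddChar F K} (hθ : θ ≠ 1) (ρ : MulChar F K) (m : ℕ)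
    (ψ : MulChar F K) : cosetProd ρ θ m ψ ≠ 0 :=
  Finset.prod_ne_zero_iff.mpr fun _ _ => gaussSum_ne_zero hθ _

omit [CharZero K] in
lemma gaussSum_mul_prod_div {m : ℕ} (hm : 0 < m) (ρ : MulChar F K) (θ : AddChar F K)
    (ψ : MulChar F K) :
    gaussSum ψ θ * ∏ b ∈ Finset.Icc 1 (m - 1),
        gaussSum (ψ * phi ρ m ^ b) θ / gaussSum (phi ρ m ^ b) θ =
      cosetProd ρ θ m ψ / ∏ b ∈ Finset.Icc 1 (m - 1), gaussSum (phi ρ m ^ b) θ := by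
  rw [Finset.prod_div_distrib, cosetProd_eq_mul hm, mul_div_assoc]

lemma gaussSum_pow_eq [HasEnoughRootsOfUnity K (Monoid.exponent Fˣ)]
    {ρ : MulChar F K} (hρ : ∀ χ, χ ∈ Subgroup.zpowers ρ) {θ : AddChar F K} (hθ : θ ≠ 1)
    {m : ℕ} (hm : 0 < m) (hmq : m ∣ Fintype.card F - 1) (ψ : MulChar F K) :
    gaussSum (ψ ^ m) θ = ψ ((m : F) ^ m) *
      (cosetProd ρ θ m ψ / ∏ b ∈ Finset.Icc 1 (m - 1), gaussSum (phi ρ m ^ b) θ) := by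
  have h := prod_gaussSum_mul_pow hm hmq (phi_pow hmq ρ)
    (fun u => pow_eq_one_of_phi_eq_one hρ m) ψ hθ
  have hQ : ∏ b ∈ Finset.Icc 1 (m - 1), gaussSum (phi ρ m ^ b) θ ≠ 0 :=
    Finset.prod_ne_zero_iff.mpr fun _ _ => gaussSum_ne_zero hθ _
  have hm' : (m : F) ^ m ≠ 0 := pow_ne_zero _ (natCast_ne_zero_of_dvd_card_sub_one hmq)
  have hψ : ψ ((m : F) ^ m) * ψ (((m : F) ^ m)⁻¹) = 1 := by
    rw [← map_mul, mul_inv_cancel₀ hm', map_one]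
  rw [cosetProd, h, mul_div_cancel_right₀ _ hQ, ← mul_assoc, hψ, one_mul]

omit [CharZero K] in
lemma prod_paramSeq (ρ : MulChar F K) (θ : AddChar F K) (m : ℕ) (B χ : MulChar F K) :
    ∏ i, gaussSum (paramSeq ρ B m i * χ) θ / gaussSum (paramSeq ρ B m i) θ =
      cosetProd ρ θ m (B * χ) / cosetProd ρ θ m B := by
  rw [cosetProd, cosetProd, ← Finset.prod_div_distrib, Finset.prod_range]
  simp only [paramSeq, mul_right_comm B _ χ]

omit [CharZero K] in
lemma prod_paramSeq_inv {m : ℕ} (hmq : m ∣ Fintype.card F - 1) (ρ : MulChar F K)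
    (θ : AddChar F K) (A χ : MulChar F K) :
    ∏ i, gaussSum (paramSeq ρ A m i * χ)⁻¹ θ / gaussSum (paramSeq ρ A m i)⁻¹ θ =
      cosetProd ρ θ m (A * χ)⁻¹ / cosetProd ρ θ m A⁻¹ := by
  rw [← cosetProd_inv hmq, ← cosetProd_inv hmq, ← Finset.prod_div_distrib, Finset.prod_range]
  simp only [paramSeq, mul_right_comm A _ χ]

omit [CharZero K] in
lemma prod_concatSeq {X : Type*} {k : ℕ} {len : Fin k → ℕ} (s : (i : Fin k) → Fin (len i) → X)
    (f : X → K) : ∏ j, f (concatSeq s j) = ∏ i, ∏ b, f (s i b) := by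
  rw [← Fintype.prod_sigma' (fun i b => f (s i b)), ← Equiv.prod_comp finSigmaFinEquiv.symm]
  rfl

theorem sum_prod_gaussSum_eq_tildeF [HasEnoughRootsOfUnity K (Monoid.exponent Fˣ)]
    {θ : AddChar F K} (hθ : θ ≠ 1) {ρ : MulChar F K} (hρ : ∀ χ, χ ∈ Subgroup.zpowers ρ)
    {n : ℕ} (α : Fin (n + 1) → ℕ) (hα : ∀ i, 0 < α i)
    (hq : ∀ i, α i ∣ Fintype.card F - 1) (hq' : ∑ i, α i ∣ Fintype.card F - 1)
    (A : Fin (n + 1) → MulChar F K) (B : MulChar F K) (x : F) :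
    ∑ χ : MulChar F K,
        (∏ i, gaussSum ((A i * χ)⁻¹ ^ α i) θ) * gaussSum ((B * χ) ^ (∑ i, α i)) θ *
          χ ((-1) ^ (∑ i, α i) * x) =
      ((Fintype.card F : K) - 1) *
        (∏ i, A i ((α i : F) ^ α i)⁻¹) * B (((∑ i, α i : ℕ) : F) ^ (∑ i, α i)) *
        (∏ i, (gaussSum (A i)⁻¹ θ *
          ∏ b ∈ Finset.Icc 1 (α i - 1),
            gaussSum ((A i)⁻¹ * phi ρ (α i) ^ b) θ / gaussSum (phi ρ (α i) ^ b) θ)) *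
        (gaussSum B θ *
          ∏ b ∈ Finset.Icc 1 ((∑ i, α i) - 1),
            gaussSum (B * phi ρ (∑ i, α i) ^ b) θ / gaussSum (phi ρ (∑ i, α i) ^ b) θ) *
        tildeF θ (paramSeq ρ B (∑ i, α i)) (concatSeq fun i => paramSeq ρ (A i) (α i))
          (((∑ i, α i : ℕ) : F) ^ (∑ i, α i) / (∏ i, (α i : F) ^ α i) * x) := by
  have hT : 0 < ∑ i, α i := Finset.sum_pos (fun i _ => hα i) Finset.univ_nonempty
  have hcard : (Fintype.card F : K) - 1 ≠ 0 := by
    rw [sub_ne_zero, Ne, Nat.cast_eq_one]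
    exact Fintype.one_lt_card.ne'
  rw [gaussSum_mul_prod_div hT,
    Finset.prod_congr rfl fun i _ => gaussSum_mul_prod_div (hα i) ρ θ (A i)⁻¹, tildeF,
    Finset.mul_sum, Finset.mul_sum]
  refine Finset.sum_congr rfl fun χ _ => ?_
  rw [prod_paramSeq, prod_concatSeq (fun i => paramSeq ρ (A i) (α i))
    (fun D => gaussSum (D * χ)⁻¹ θ / gaussSum D⁻¹ θ)]
  simp only [prod_paramSeq_inv (hq _)]
  rw [gaussSum_pow_eq hρ hθ hT hq',
    Finset.prod_congr rfl fun i _ => gaussSum_pow_eq hρ hθ (hα i) (hq i) (A i * χ)⁻¹]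
  set T := ∑ i, α i
  have hB := cosetProd_ne_zero hθ ρ T B
  have hA : ∏ i, cosetProd ρ θ (α i) (A i)⁻¹ ≠ 0 :=
    Finset.prod_ne_zero_iff.mpr fun i _ => cosetProd_ne_zero hθ ρ _ _
  have hinv : ∀ i, (A i * χ)⁻¹ ((α i : F) ^ α i) =
      A i ((α i : F) ^ α i)⁻¹ * χ ((α i : F) ^ α i)⁻¹ := fun i => by
    rw [MulChar.inv_apply', MulChar.mul_apply]
  simp only [hinv, Finset.prod_mul_distrib, Finset.prod_div_distrib, MulChar.mul_apply, map_mul,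
    map_pow χ (-1), div_eq_mul_inv ((T : F) ^ T), ← Finset.prod_inv_distrib, map_prod χ]
  -- Only `q - 1` and the coset products without `χ` must cancel between the prefactor and `tildeF`,
  -- so only these need to be nonzero.
  generalize (Fintype.card F : K) - 1 = c at hcard
  generalize ∏ i, cosetProd ρ θ (α i) (A i)⁻¹ = p at hA
  generalize cosetProd ρ θ T B = r at hB
  generalize ∏ i, cosetProd ρ θ (α i) (A i * χ)⁻¹ = p'
  generalize cosetProd ρ θ T (B * χ) = r'
  generalize ∏ i, A i ((α i : F) ^ α i)⁻¹ = a
  generalize ∏ i, χ ((α i : F) ^ α i)⁻¹ = a'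
  generalize ∏ i, ∏ b ∈ Finset.Icc 1 (α i - 1), gaussSum (phi ρ (α i) ^ b) θ = s
  generalize ∏ b ∈ Finset.Icc 1 (T - 1), gaussSum (phi ρ T ^ b) θ = t
  generalize χ (-1) ^ T = e
  generalize B ((T : F) ^ T) = w
  generalize χ ((T : F) ^ T) = w'
  generalize χ x = y
  field_simp

end Parameters

end FiniteHGF

theorem mainTheorem7 {F : Type*} [Field F] [Fintype F] {ℓ : ℕ} [Fact ℓ.Prime]
    (θ : AddChar F (AlgebraicClosure ℚ_[ℓ])) (hθ : θ ≠ 1)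
    (ρ : MulChar F (AlgebraicClosure ℚ_[ℓ])) (hρ : ∀ χ, χ ∈ Subgroup.zpowers ρ)
    {n : ℕ} (α : Fin (n + 1) → ℕ) (hα : ∀ i, 0 < α i)
    (hq : ∀ i, Fintype.card F ≡ 1 [MOD α i]) (hq' : Fintype.card F ≡ 1 [MOD ∑ i, α i])
    (A : Fin (n + 1) → MulChar F (AlgebraicClosure ℚ_[ℓ]))
    (B : MulChar F (AlgebraicClosure ℚ_[ℓ])) (x : F) :
    ∑ χ : MulChar F (AlgebraicClosure ℚ_[ℓ]),
        (∏ i, gaussSum ((A i * χ)⁻¹ ^ α i) θ) * gaussSum ((B * χ) ^ (∑ i, α i)) θ *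
          χ ((-1) ^ (∑ i, α i) * x) =
      ((Fintype.card F : AlgebraicClosure ℚ_[ℓ]) - 1) *
        (∏ i, A i ((α i : F) ^ α i)⁻¹) * B (((∑ i, α i : ℕ) : F) ^ (∑ i, α i)) *
        (∏ i, (gaussSum (A i)⁻¹ θ *
          ∏ b ∈ Finset.Icc 1 (α i - 1),
            gaussSum ((A i)⁻¹ * FiniteHGF.phi ρ (α i) ^ b) θ /
              gaussSum (FiniteHGF.phi ρ (α i) ^ b) θ)) *
        (gaussSum B θ *
          ∏ b ∈ Finset.Icc 1 ((∑ i, α i) - 1),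
            gaussSum (B * FiniteHGF.phi ρ (∑ i, α i) ^ b) θ /
              gaussSum (FiniteHGF.phi ρ (∑ i, α i) ^ b) θ) *
        FiniteHGF.tildeF θ (FiniteHGF.paramSeq ρ B (∑ i, α i))
          (FiniteHGF.concatSeq fun i => FiniteHGF.paramSeq ρ (A i) (α i))
          (((∑ i, α i : ℕ) : F) ^ (∑ i, α i) / (∏ i, (α i : F) ^ α i) * x) := by
  have hdvd : ∀ {m : ℕ}, Fintype.card F ≡ 1 [MOD m] → m ∣ Fintype.card F - 1 := fun h =>
    (Nat.modEq_iff_dvd' Fintype.card_pos).mp h.symm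
  have : NeZero (Monoid.exponent Fˣ) := ⟨Monoid.exponent_ne_zero_of_finite⟩
  exact FiniteHGF.sum_prod_gaussSum_eq_tildeF hθ hρ α hα (fun i => hdvd (hq i)) (hdvd hq') A B x
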